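/- Let $X$ be a real Banach space, $T>0$, $I=[0,T]$, $\alpha\ge 0$, $m\in\mathbb N$, and let $U\subset\mathbb R^m$ be compact and convex. Let $A\colon D(A)\subset X\to X$ generate a $C_0$-semigroup $(S_t)_{t\ge 0}$ on $X$, and let $f\colon I\times X\to X$, $G\colon I\times X\to\mathcal L(\mathbb R^m;X)$ and $\ell\colon X\to\mathbb R$ be given. Write $F_t(\mathrm x,\mathrm u)=f_t(\mathrm x)+G_t(\mathrm x)\mathrm u$ and $\mathcal U=L^\infty(I;U)$. Measurability is understood in the strong (Bochner) sense, $|\cdot|$ is the Euclidean norm, and $L'$ is the adjoint of an operator $L$, with $(\mathbb R^m)'$ identified with $\mathbb R^m$. Assume: (A) for every $\mathrm x\in X$ the maps $t\mapsto f_t(\mathrm x)$ and $t\mapsto G_t(\mathrm x)$ are measurable, and there are constants $M_f,M_G\ge0$ such that for a.e. $t\in I$ and all $\mathrm x,\mathrm y\in X$: $\|f_t(\mathrm x)-f_t(\mathrm y)\|\le M_f\|\mathrm x-\mathrm y\|$, $\|G_t(\mathrm x)-G_t(\mathrm y)\|\le M_G\|\mathrm x-\mathrm y\|$, $\|f_t(0)\|\le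 M_f$, $\|G_t(0)\|\le M_G$; (A$_+$) for a.e. $t\in I$ the maps $f_t$ and $G_t$ are of class $C^1$; for every $\mathrm x\in X$ the maps $t\mapsto Df_t(\mathrm x)$ and $t\mapsto DG_t(\mathrm x)$ are measurable; and for some $M\ge 0$ and a.e. $t\in I$ the maps $\mathrm x\mapsto Df_t(\mathrm x)$ and $\mathrm x\mapsto DG_t(\mathrm x)$ are bounded by $M$ and Lipschitz with constant $M$ on $X$; and $\ell\in C^1(X)$ is Lipschitz on bounded subsets of $X$. Then for all $v\in\mathcal U$, $s\in I$ and $\mathrm x\in X$ there is a unique mild solution on $[s,T]$ of $\dot x_t=Ax_t+F_t(x_t,v(t))$, $x_s=\mathrm x$, that is, a unique continuous map $t\mapsto\Phi^v_{s,t}(\mathrm x)$ on $[s,T]$ with $$\Phi^v_{s,t}(\mathrm x)=S_{t-s}\mathrm x+\int_s^t S_{t-\tau}F_\tau\bigl(\Phi^v_{s,\tau}(\mathrm x),v(\tau)\bigr)\,d\tau ,\qquad t\in[s,T].$$ For $\mathrm x_0\in X$ and $v\in\mathcal U$ put $x^v_t=\Phi^v_{0,t}(\mathrm x_0)$ and $\mathcal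 I[v]=\ell(x^v_T)+\frac\alpha2\int_I|v(t)|^2\,dt$. Let $u,\bar u\in\mathcal U$, write $x_t=x^u_t$ and $\bar p_t=\ell\circ\Phi^{\bar u}_{t,T}$ for $t\in I$. Then $\bar p_t$ is Fréchet differentiable on $X$ for every $t\in I$, the function $g(t)=\bar p_t(x_t)$ is absolutely continuous on $I$, and for a.e. $t\in I$ it is differentiable at $t$ with $$g'(t)=(u(t)-\bar u(t))^{T}\,G_t(x_t)'\,D\bar p_t(x_t).$$ Moreover, with the reduced Hamiltonian $\bar H_t(\mathrm x,\mathrm u)=\frac\alpha2|\mathrm u|^2+\mathrm u^{T}G_t(\mathrm x)'D\bar p_t(\mathrm x)$, the function $t\mapsto\bar H_t(x_t,u(t))-\bar H_t(x_t,\bar u(t))$ is integrable on $I$ and $$\mathcal I[u]-\mathcal I[\bar u]=\int_I\bigl(\bar H_t(x_t,u(t))-\bar H_t(x_t,\bar u(t))\bigr)\,dt .$$ -/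

import Mathlib

open MeasureTheory Set Filter Topology
open scoped NNReal

namespace MildControl

noncomputable section

variable {X : Type*} [NormedAddCommGroup X] [NormedSpace ℝ X] {m : ℕ}

/-- A strongly continuous semigroup of bounded linear operators; only the values `S t` with
`0 ≤ t` matter. -/
structure IsC0Semigroup (S : ℝ → X →L[ℝ] X) : Prop where
  map_zero : S 0 = ContinuousLinearMap.id ℝ X
  map_add : ∀ t τ : ℝ, 0 ≤ t → 0 ≤ τ → S (t + τ) = (S t).comp (S τ)
  continuousOn_orbit : ∀ x : X, ContinuousOn (fun t : ℝ => S t x) (Ici 0)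

/-- The (possibly unbounded) operator `A` with domain `D(A) ⊆ X` is the infinitesimal generator
of `S`: its domain consists of the `x` for which the right derivative at `0` of `t ↦ S t x`
exists, and `A x` is that derivative. -/
def IsGenerator (A : X →ₗ.[ℝ] X) (S : ℝ → X →L[ℝ] X) : Prop :=
  (∀ x : X, x ∈ A.domain ↔ ∃ y : X, Tendsto (fun h : ℝ => h⁻¹ • (S h x - x)) (𝓝[>] 0) (𝓝 y)) ∧
  ∀ x : A.domain,
    Tendsto (fun h : ℝ => h⁻¹ • (S h (x : X) - (x : X))) (𝓝[>] 0) (𝓝 (A x))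

/-- Admissible controls: representatives of the elements of `L^∞(I; U)`, `I = [0, T]`. As `U` is
compact in the use made of it, essential boundedness is automatic. -/
structure IsAdmissible (T : ℝ) (U : Set (EuclideanSpace ℝ (Fin m)))
    (u : ℝ → EuclideanSpace ℝ (Fin m)) : Prop where
  aestronglyMeasurable : AEStronglyMeasurable u (volume.restrict (Icc 0 T))
  mem : ∀ᵐ t ∂(volume.restrict (Icc 0 T)), u t ∈ U

/-- Assumption (A): strong measurability in time, Lipschitz continuity in the state, and
boundedness at the origin, for almost all times in `[0, T]`. -/
structure AssumptionA (T : ℝ) (f : ℝ → X → X)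
    (G : ℝ → X → EuclideanSpace ℝ (Fin m) →L[ℝ] X) : Prop where
  meas_f : ∀ x : X, AEStronglyMeasurable (fun t => f t x) (volume.restrict (Icc 0 T))
  meas_G : ∀ x : X, AEStronglyMeasurable (fun t => G t x) (volume.restrict (Icc 0 T))
  bounds : ∃ Mf MG : ℝ, 0 ≤ Mf ∧ 0 ≤ MG ∧
    ∀ᵐ t ∂(volume.restrict (Icc 0 T)),
      (∀ x y : X, ‖f t x - f t y‖ ≤ Mf * ‖x - y‖) ∧
      (∀ x y : X, ‖G t x - G t y‖ ≤ MG * ‖x - y‖) ∧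
      ‖f t 0‖ ≤ Mf ∧ ‖G t 0‖ ≤ MG

/-- Assumption (A+): `C¹` regularity in the state for almost all times, with derivatives that are
strongly measurable in time, and bounded and Lipschitz in the state with a common constant. -/
structure AssumptionAPlus (T : ℝ) (f : ℝ → X → X)
    (G : ℝ → X → EuclideanSpace ℝ (Fin m) →L[ℝ] X) : Prop where
  contDiff : ∀ᵐ t ∂(volume.restrict (Icc 0 T)), ContDiff ℝ 1 (f t) ∧ ContDiff ℝ 1 (G t)
  meas_Df : ∀ x : X,
    AEStronglyMeasurable (fun t => fderiv ℝ (f t) x) (volume.restrict (Icc 0 T))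
  meas_DG : ∀ x : X,
    AEStronglyMeasurable (fun t => fderiv ℝ (G t) x) (volume.restrict (Icc 0 T))
  bounds : ∃ M : ℝ, 0 ≤ M ∧
    ∀ᵐ t ∂(volume.restrict (Icc 0 T)),
      (∀ x : X, ‖fderiv ℝ (f t) x‖ ≤ M) ∧
      (∀ x : X, ‖fderiv ℝ (G t) x‖ ≤ M) ∧
      (∀ x y : X, ‖fderiv ℝ (f t) x - fderiv ℝ (f t) y‖ ≤ M * ‖x - y‖) ∧
      (∀ x y : X, ‖fderiv ℝ (G t) x - fderiv ℝ (G t) y‖ ≤ M * ‖x - y‖)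

/-- The right-hand side `F_t(x, v) = f_t(x) + G_t(x) v`. -/
def field (f : ℝ → X → X) (G : ℝ → X → EuclideanSpace ℝ (Fin m) →L[ℝ] X)
    (t : ℝ) (x : X) (v : EuclideanSpace ℝ (Fin m)) : X :=
  f t x + G t x v

/-- `y` is a mild solution on `[s, T]` of `ẏ = A y + F_t(y, u(t))`, `y_s = x`, where `S` is the
semigroup generated by `A`. -/
structure IsMildSolution (S : ℝ → X →L[ℝ] X) (f : ℝ → X → X)
    (G : ℝ → X → EuclideanSpace ℝ (Fin m) →L[ℝ] X) (T : ℝ)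
    (u : ℝ → EuclideanSpace ℝ (Fin m)) (s : ℝ) (x : X) (y : ℝ → X) : Prop where
  continuousOn : ContinuousOn y (Icc s T)
  integrable : ∀ t ∈ Icc s T,
    IntervalIntegrable (fun τ => S (t - τ) (field f G τ (y τ) (u τ))) volume s t
  eq : ∀ t ∈ Icc s T, y t = S (t - s) x + ∫ τ in s..t, S (t - τ) (field f G τ (y τ) (u τ))

open Classical in
/-- The evolution map `Φ^u_{s,t}(x)`: the value at `t` of the mild solution with data `(s, x)`. -/
def flow (S : ℝ → X →L[ℝ] X) (f : ℝ → X → X)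
    (G : ℝ → X → EuclideanSpace ℝ (Fin m) →L[ℝ] X) (T : ℝ)
    (u : ℝ → EuclideanSpace ℝ (Fin m)) (s t : ℝ) (x : X) : X :=
  if h : ∃ y : ℝ → X, IsMildSolution S f G T u s x y then h.choose t else 0

/-- The propagated terminal cost `p_t = ℓ ∘ Φ^u_{t,T}`. -/
def propCost (S : ℝ → X →L[ℝ] X) (f : ℝ → X → X)
    (G : ℝ → X → EuclideanSpace ℝ (Fin m) →L[ℝ] X) (T : ℝ) (ℓ : X → ℝ)
    (u : ℝ → EuclideanSpace ℝ (Fin m)) (t : ℝ) (x : X) : ℝ :=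
  ℓ (flow S f G T u t T x)

/-- The cost functional `ℓ(x_T^u) + (α/2) ∫_I |u(t)|² dt`. -/
def cost (S : ℝ → X →L[ℝ] X) (f : ℝ → X → X)
    (G : ℝ → X → EuclideanSpace ℝ (Fin m) →L[ℝ] X) (T : ℝ) (ℓ : X → ℝ) (α : ℝ) (x₀ : X)
    (u : ℝ → EuclideanSpace ℝ (Fin m)) : ℝ :=
  ℓ (flow S f G T u 0 T x₀) + α / 2 * ∫ t in Icc 0 T, ‖u t‖ ^ 2

/-- For `L : ℝᵐ → X` and `φ ∈ X'`, the functional `φ ∘ L`, that is `L' φ`, as a vector of `ℝᵐ`. -/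
def adjointVec (L : EuclideanSpace ℝ (Fin m) →L[ℝ] X) (φ : X →L[ℝ] ℝ) :
    EuclideanSpace ℝ (Fin m) :=
  (InnerProductSpace.toDual ℝ (EuclideanSpace ℝ (Fin m))).symm (φ.comp L)

/-- The reduced Hamiltonian `(α/2)|v|² + vᵀ G_t(x)' Dp_t(x)`, with `p` propagated along `ubar`. -/
def hamiltonian (S : ℝ → X →L[ℝ] X) (f : ℝ → X → X)
    (G : ℝ → X → EuclideanSpace ℝ (Fin m) →L[ℝ] X) (T : ℝ) (ℓ : X → ℝ) (α : ℝ)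
    (ubar : ℝ → EuclideanSpace ℝ (Fin m)) (t : ℝ) (x : X) (v : EuclideanSpace ℝ (Fin m)) : ℝ :=
  α / 2 * ‖v‖ ^ 2 + inner ℝ v (adjointVec (G t x) (fderiv ℝ (propCost S f G T ℓ ubar t) x))

end

end MildControl

open MildControl

/-! Trajectories need not be differentiable in time, so `g` is not differentiated along the state
equation. For `r ≤ t` the flow property gives `g(r) = p̄_t(Φ_{r,t}(x_r))`, where `Φ` is the flow of
`ū`: only the argument of the fixed function `p̄_t` moves with `r`. By Duhamel's formula, `x_t -
Φ_{r,t}(x_r)` is the integral over `[r,t]` of `S_{t-τ}` applied to `F_τ(x_τ,u) -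
F_τ(Φ_{r,τ}(x_r),ū)`. At a Lebesgue point `t` of `F_τ(x_τ,u) - F_τ(x_τ,ū) = G_τ(x_τ)(u-ū)`, dividing
by `t - r` and letting `r ↑ t` yields the left derivative (`ae_hasDerivWithinAt_evolution`), and the
chain rule for `p̄_t` gives that of `g`. Since `g` is Lipschitz (`exists_lipschitzOnWith_cost`), it
is differentiable almost everywhere, and the left derivative is then the derivative. Integrating
`g'` gives the increment formula, because `g(T) = ℓ(x_T)` and `g(0)` is the terminal cost of `ū`.

The flow is handled through Volterra equations: existence by Picard iteration, uniqueness and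
stability by Grönwall, and differentiability in the initial state by comparison with the linearised
equation (`IsVolterraSolution.differentiable`). -/

namespace MildControl

/-! ### Carathéodory fields and superposition -/

section Caratheodory

variable {X E : Type*} [NormedAddCommGroup X] [NormedAddCommGroup E]

/-- Carathéodory fields, Lipschitz in the state. -/
structure IsCaratheodory (F : ℝ → X → E) (J : Set ℝ) (L : ℝ) : Prop where
  nonneg : 0 ≤ L
  aestronglyMeasurable : ∀ x : X, AEStronglyMeasurable (fun t => F t x) (volume.restrict J)
  lipschitz : ∀ᵐ t ∂(volume.restrict J), ∀ x y : X, ‖F t x - F t y‖ ≤ L * ‖x - y‖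
  norm_zero_le : ∀ᵐ t ∂(volume.restrict J), ‖F t 0‖ ≤ L

/-- The superposition of a map that is measurable in time and continuous in the state with a
measurable curve is measurable. -/
lemma aestronglyMeasurable_superposition {μ : Measure ℝ} {F : ℝ → X → E} {y : ℝ → X}
    (hF : ∀ x : X, AEStronglyMeasurable (fun t => F t x) μ)
    (hc : ∀ᵐ t ∂μ, Continuous (F t)) (hy : AEStronglyMeasurable y μ) :
    AEStronglyMeasurable (fun t => F t (y t)) μ := by
  -- Along a simple curve the superposition is a finite sum of indicators of fixed-state maps;
  -- continuity in the state then passes to the limit.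
  have hs : ∀ g : SimpleFunc ℝ X, AEStronglyMeasurable (fun t => F t (g t)) μ := by
    intro g
    have : (fun t => F t (g t)) = fun t =>
        ∑ c ∈ g.range, (g ⁻¹' {c}).indicator (fun t => F t c) t := by
      ext t
      rw [Finset.sum_eq_single (g t)]
      · simp
      · intro c _ hc
        exact indicator_of_notMem (fun h => hc (by simpa using h.symm)) _
      · intro h
        exact absurd (g.mem_range_self t) h
    rw [this]
    exact Finset.aestronglyMeasurable_fun_sum _ fun c _ =>
      (hF c).indicator (g.measurableSet_fiber c)
  obtain ⟨z, hz, hyz⟩ := hy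
  refine aestronglyMeasurable_of_tendsto_ae atTop (fun n => hs (hz.approx n)) ?_
  filter_upwards [hc, hyz] with t ht h
  rw [h]
  exact (ht.tendsto _).comp (hz.tendsto_approx t)

namespace IsCaratheodory

variable {F : ℝ → X → E} {J : Set ℝ} {L : ℝ}

lemma mono (hF : IsCaratheodory F J L) {J' : Set ℝ} (h : J' ⊆ J) : IsCaratheodory F J' L where
  nonneg := hF.nonneg
  aestronglyMeasurable x := (hF.aestronglyMeasurable x).mono_measure (Measure.restrict_mono_set _ h)
  lipschitz := ae_restrict_of_ae_restrict_of_subset h hF.lipschitz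
  norm_zero_le := ae_restrict_of_ae_restrict_of_subset h hF.norm_zero_le

lemma ae_continuous (hF : IsCaratheodory F J L) :
    ∀ᵐ t ∂(volume.restrict J), Continuous (F t) := by
  filter_upwards [hF.lipschitz] with t ht
  exact (LipschitzWith.of_dist_le_mul (K := ⟨L, hF.nonneg⟩) fun x y => by
    simpa [dist_eq_norm] using! ht x y).continuous

lemma norm_le (hF : IsCaratheodory F J L) :
    ∀ᵐ t ∂(volume.restrict J), ∀ x, ‖F t x‖ ≤ L * ‖x‖ + L := by
  filter_upwards [hF.lipschitz, hF.norm_zero_le] with t h1 h2 x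
  have := norm_add_le (F t x - F t 0) (F t 0)
  have h3 := h1 x 0
  simp only [sub_add_cancel, sub_zero] at this h3
  linarith

lemma integrableOn_comp {s T : ℝ} (hF : IsCaratheodory F (Icc s T) L) {y : ℝ → X}
    (hy : ContinuousOn y (Icc s T)) : IntegrableOn (fun t => F t (y t)) (Icc s T) := by
  have hm := aestronglyMeasurable_superposition hF.aestronglyMeasurable hF.ae_continuous
    (hy.aestronglyMeasurable_of_isCompact isCompact_Icc measurableSet_Icc)
  have hi : IntegrableOn (fun t => L * ‖y t‖ + L) (Icc s T) :=
    ((hy.norm.const_smul L).add continuousOn_const).integrableOn_Icc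
  refine Integrable.mono' hi hm ?_
  filter_upwards [hF.norm_le] with t ht
  exact ht _

end IsCaratheodory

end Caratheodory

/-! ### Volterra equations: convolutions, Grönwall, Picard iteration -/

section Volterra

variable {X : Type*} [NormedAddCommGroup X] [NormedSpace ℝ X]

/-- A strongly continuous, uniformly bounded family of operators on the line. -/
structure IsStrongFamily (W : ℝ → X →L[ℝ] X) (C : ℝ) : Prop where
  continuous_orbit : ∀ x : X, Continuous fun t => W t x
  norm_le : ∀ t : ℝ, ‖W t‖ ≤ C

namespace IsStrongFamily

variable {W : ℝ → X →L[ℝ] X} {C : ℝ}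

lemma nonneg (hW : IsStrongFamily W C) : 0 ≤ C := (norm_nonneg _).trans (hW.norm_le 0)

lemma norm_apply_le (hW : IsStrongFamily W C) (t : ℝ) (x : X) : ‖W t x‖ ≤ C * ‖x‖ :=
  (W t).le_of_opNorm_le (hW.norm_le t) x

/-- Only strong continuity in time is available: the uniform bound absorbs the change of vector, and
the orbit of the fixed vector is continuous. -/
lemma continuous_uncurry (hW : IsStrongFamily W C) :
    Continuous fun p : ℝ × X => W p.1 p.2 := by
  refine continuous_iff_continuousAt.2 fun p => ?_
  have h1 : Tendsto (fun q : ℝ × X => W q.1 (q.2 - p.2)) (𝓝 p) (𝓝 0) := by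
    refine squeeze_zero_norm (fun q => hW.norm_apply_le q.1 (q.2 - p.2)) ?_
    have : Continuous fun q : ℝ × X => C * ‖q.2 - p.2‖ := by fun_prop
    simpa using this.tendsto p
  have h2 : Tendsto (fun q : ℝ × X => W q.1 p.2) (𝓝 p) (𝓝 (W p.1 p.2)) :=
    ((hW.continuous_orbit p.2).comp continuous_fst).tendsto p
  have h3 := h1.add h2
  simp only [zero_add] at h3
  refine h3.congr fun q => ?_
  simp

lemma aestronglyMeasurable_conv (hW : IsStrongFamily W C) {μ : Measure ℝ} {ψ : ℝ → X}
    (hψ : AEStronglyMeasurable ψ μ) (t : ℝ) :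
    AEStronglyMeasurable (fun τ => W (t - τ) (ψ τ)) μ :=
  hW.continuous_uncurry.comp_aestronglyMeasurable
    ((continuous_const.sub continuous_id).aestronglyMeasurable.prodMk hψ)

lemma integrable_conv (hW : IsStrongFamily W C) {μ : Measure ℝ} {ψ : ℝ → X}
    (hψ : Integrable ψ μ) (t : ℝ) : Integrable (fun τ => W (t - τ) (ψ τ)) μ :=
  (hψ.norm.const_mul C).mono' (hW.aestronglyMeasurable_conv hψ.1 t)
    (Eventually.of_forall fun _ => hW.norm_apply_le _ _)

lemma intervalIntegrable_conv (hW : IsStrongFamily W C) {ψ : ℝ → X} {s T : ℝ}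
    (hψ : IntegrableOn ψ (Icc s T)) {a b : ℝ} (ha : a ∈ Icc s T) (hb : b ∈ Icc s T) (t : ℝ) :
    IntervalIntegrable (fun τ => W (t - τ) (ψ τ)) volume a b :=
  (IntegrableOn.mono_set (hW.integrable_conv hψ t) (uIcc_subset_Icc ha hb)).intervalIntegrable

/-- Both the upper limit and the integrand depend on `t`. They are treated as independent variables
by dominated convergence, then restricted to the diagonal. -/
lemma continuousOn_conv (hW : IsStrongFamily W C) {ψ : ℝ → X} {s T : ℝ}
    (hψ : IntegrableOn ψ (Icc s T)) :
    ContinuousOn (fun t => ∫ τ in s..t, W (t - τ) (ψ τ)) (Icc s T) := by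
  have hψ' : Integrable ((Icc s T).indicator ψ) := hψ.integrable_indicator measurableSet_Icc
  have key : Continuous fun t => ∫ τ in s..t, W (t - τ) ((Icc s T).indicator ψ τ) := by
    refine continuous_iff_continuousAt.2 fun t₀ => ?_
    have := intervalIntegral.continuousAt_parametric_primitive_of_dominated
      (μ := volume) (F := fun t τ => W (t - τ) ((Icc s T).indicator ψ τ))
      (fun τ => C * ‖(Icc s T).indicator ψ τ‖) (min s t₀ - 1) (max s t₀ + 1) (a₀ := s)
      (b₀ := t₀) (x₀ := t₀)
      (fun t => (hW.aestronglyMeasurable_conv hψ'.1 t).restrict)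
      (Eventually.of_forall fun _ => Eventually.of_forall fun _ => hW.norm_apply_le _ _)
      ((hψ'.norm.const_mul C).intervalIntegrable)
      (Eventually.of_forall fun τ =>
        ((hW.continuous_orbit _).comp (continuous_id.sub continuous_const)).continuousAt)
      ⟨by linarith [min_le_left s t₀], by linarith [le_max_left s t₀]⟩
      ⟨by linarith [min_le_right s t₀], by linarith [le_max_right s t₀]⟩ (by simp)
    exact this.comp (f := fun t => (t, t)) (continuous_id.prodMk continuous_id).continuousAt
  refine key.continuousOn.congr fun t ht => ?_
  refine intervalIntegral.integral_congr fun τ hτ => ?_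
  have : τ ∈ Icc s T := by
    rw [uIcc_of_le ht.1] at hτ
    exact ⟨hτ.1, hτ.2.trans ht.2⟩
  simp [this]

lemma norm_conv_le (hW : IsStrongFamily W C) {ψ : ℝ → X} {a b t : ℝ} (hab : a ≤ b)
    {ρ : ℝ → ℝ} (hρ : IntervalIntegrable ρ volume a b)
    (h : ∀ᵐ τ ∂(volume.restrict (Icc a b)), ‖ψ τ‖ ≤ ρ τ) :
    ‖∫ τ in a..b, W (t - τ) (ψ τ)‖ ≤ C * ∫ τ in a..b, ρ τ := by
  rw [← intervalIntegral.integral_const_mul]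
  refine intervalIntegral.norm_integral_le_of_norm_le hab ?_ (hρ.const_mul C)
  rw [ae_restrict_iff' measurableSet_Icc] at h
  filter_upwards [h] with τ hτ hm
  exact (hW.norm_apply_le _ _).trans
    (mul_le_mul_of_nonneg_left (hτ (Ioc_subset_Icc_self hm)) hW.nonneg)

lemma norm_conv_le_const (hW : IsStrongFamily W C) {ψ : ℝ → X} {a b t c : ℝ} (hab : a ≤ b)
    (h : ∀ᵐ τ ∂(volume.restrict (Icc a b)), ‖ψ τ‖ ≤ c) :
    ‖∫ τ in a..b, W (t - τ) (ψ τ)‖ ≤ C * c * (b - a) := by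
  have := hW.norm_conv_le (t := t) hab (ρ := fun _ => c) (by simp) h
  simp only [intervalIntegral.integral_const, smul_eq_mul] at this
  linarith

end IsStrongFamily

/-- Integral form of Grönwall's inequality. -/
lemma le_mul_exp_of_le_add_integral {φ : ℝ → ℝ} {s T δ K : ℝ} (hφ : ContinuousOn φ (Icc s T))
    (h0 : ∀ t ∈ Icc s T, 0 ≤ φ t) (hK : 0 ≤ K)
    (h : ∀ t ∈ Icc s T, φ t ≤ δ + K * ∫ τ in s..t, φ τ) :
    ∀ t ∈ Icc s T, φ t ≤ δ * Real.exp (K * (t - s)) := by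
  intro t ht
  have hsT : s ≤ T := ht.1.trans ht.2
  -- The continuous extension makes the primitive differentiable at every point, endpoints included.
  set χ : ℝ → ℝ := IccExtend hsT ((Icc s T).domRestrict φ) with hχ
  have hχc : Continuous χ := hφ.domRestrict.Icc_extend'
  have hχe : ∀ r ∈ Icc s T, χ r = φ r := fun r hr => by
    simp [hχ, IccExtend_of_mem hsT _ hr, domRestrict]
  have hint : ∀ r ∈ Icc s T, ∫ τ in s..r, χ τ = ∫ τ in s..r, φ τ := fun r hr =>
    intervalIntegral.integral_congr fun τ hτ => by
      rw [uIcc_of_le hr.1] at hτ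
      exact hχe τ ⟨hτ.1, hτ.2.trans hr.2⟩
  have hnn : ∀ r ∈ Icc s T, 0 ≤ ∫ τ in s..r, χ τ := fun r hr =>
    intervalIntegral.integral_nonneg hr.1 fun τ hτ => by
      have hm : τ ∈ Icc s T := ⟨hτ.1, hτ.2.trans hr.2⟩
      rw [hχe τ hm]; exact h0 τ hm
  have hd : ∀ r, HasDerivAt (fun r => ∫ τ in s..r, χ τ) (χ r) r := fun r =>
    intervalIntegral.integral_hasDerivAt_right (hχc.intervalIntegrable _ _)
      hχc.aestronglyMeasurable.stronglyMeasurableAtFilter hχc.continuousAt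
  -- The differential Grönwall inequality is applied to the primitive, as `φ` itself is only
  -- continuous; the initial value is `0` and `δ` becomes the forcing term.
  have hb := norm_le_gronwallBound_of_norm_deriv_right_le (f := fun r => ∫ τ in s..r, χ τ)
    (f' := χ) (δ := 0) (K := K) (ε := δ) (a := s) (b := T)
    (fun r _ => (hd r).continuousAt.continuousWithinAt)
    (fun r _ => (hd r).hasDerivWithinAt) (by simp)
    (fun r hr => by
      have hm := Ico_subset_Icc_self hr
      rw [Real.norm_of_nonneg (hnn r hm), hχe r hm, Real.norm_of_nonneg (h0 r hm), hint r hm]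
      linarith [h r hm]) t ht
  rw [Real.norm_of_nonneg (hnn t ht), hint t ht] at hb
  refine (h t ht).trans ?_
  rcases hK.eq_or_lt with rfl | hK'
  · simp
  · rw [gronwallBound_of_K_ne_0 hK'.ne'] at hb
    have := mul_le_mul_of_nonneg_left hb hK
    have e : K * (0 * Real.exp (K * (t - s)) + δ / K * (Real.exp (K * (t - s)) - 1))
      = δ * Real.exp (K * (t - s)) - δ := by field_simp; ring
    linarith

/-- On `[s, T]`, `y` is the sum of `a` and the convolution of `W` with `ψ`. -/
structure IsConvolution (W : ℝ → X →L[ℝ] X) (s T : ℝ) (a ψ y : ℝ → X) : Prop where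
  continuousOn : ContinuousOn y (Icc s T)
  integrableOn : IntegrableOn ψ (Icc s T)
  eq : ∀ t ∈ Icc s T, y t = a t + ∫ τ in s..t, W (t - τ) (ψ τ)

namespace IsConvolution

variable {W : ℝ → X →L[ℝ] X} {C s T : ℝ} {a₁ ψ₁ y₁ a₂ ψ₂ y₂ a ψ y : ℝ → X}

lemma add (hW : IsStrongFamily W C) (h₁ : IsConvolution W s T a₁ ψ₁ y₁)
    (h₂ : IsConvolution W s T a₂ ψ₂ y₂) :
    IsConvolution W s T (fun t => a₁ t + a₂ t) (fun t => ψ₁ t + ψ₂ t)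
      (fun t => y₁ t + y₂ t) where
  continuousOn := h₁.continuousOn.add h₂.continuousOn
  integrableOn := h₁.integrableOn.add h₂.integrableOn
  eq t ht := by
    have hs : s ∈ Icc s T := ⟨le_rfl, ht.1.trans ht.2⟩
    simp only [map_add]
    rw [intervalIntegral.integral_add (hW.intervalIntegrable_conv h₁.integrableOn hs ht t)
      (hW.intervalIntegrable_conv h₂.integrableOn hs ht t), h₁.eq t ht, h₂.eq t ht]
    abel

lemma const_smul (c : ℝ) (h : IsConvolution W s T a ψ y) :
    IsConvolution W s T (fun t => c • a t) (fun t => c • ψ t) (fun t => c • y t) where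
  continuousOn := h.continuousOn.const_smul c
  integrableOn := h.integrableOn.smul c
  eq t ht := by simp [h.eq t ht]

lemma sub (hW : IsStrongFamily W C) (h₁ : IsConvolution W s T a₁ ψ₁ y₁)
    (h₂ : IsConvolution W s T a₂ ψ₂ y₂) :
    IsConvolution W s T (fun t => a₁ t - a₂ t) (fun t => ψ₁ t - ψ₂ t)
      (fun t => y₁ t - y₂ t) := by
  simpa [sub_eq_add_neg] using h₁.add hW (h₂.const_smul (-1))

/-- Grönwall's inequality for convolutions. -/
lemma norm_le (hW : IsStrongFamily W C) (h : IsConvolution W s T a ψ y) {δ L ε : ℝ}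
    (hs : 0 ≤ s) (hL : 0 ≤ L) (hε : 0 ≤ ε) (ha : ∀ t ∈ Icc s T, ‖a t‖ ≤ δ)
    (hψ : ∀ᵐ τ ∂(volume.restrict (Icc s T)), ‖ψ τ‖ ≤ L * ‖y τ‖ + ε) :
    ∀ t ∈ Icc s T, ‖y t‖ ≤ (δ + C * ε * T) * Real.exp (C * L * T) := by
  intro t ht
  have hC := hW.nonneg
  have hδ : 0 ≤ δ := (norm_nonneg _).trans (ha t ht)
  have key := le_mul_exp_of_le_add_integral (φ := fun t => ‖y t‖) (δ := δ + C * ε * T)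
    (K := C * L) h.continuousOn.norm (fun _ _ => norm_nonneg _) (by positivity)
    (fun r hr => by
      have hsub : Icc s r ⊆ Icc s T := Icc_subset_Icc_right hr.2
      have hi : IntervalIntegrable (fun τ => ‖y τ‖) volume s r :=
        (h.continuousOn.norm.mono (by rw [uIcc_of_le hr.1]; exact hsub)).intervalIntegrable
      have h1 := hW.norm_conv_le (t := r) hr.1 (ρ := fun τ => L * ‖y τ‖ + ε)
        ((hi.const_mul L).add (by simp)) (ae_restrict_of_ae_restrict_of_subset hsub hψ)
      rw [intervalIntegral.integral_add (hi.const_mul L) (by simp),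
        intervalIntegral.integral_const_mul, intervalIntegral.integral_const, smul_eq_mul] at h1
      -- As `0 ≤ s`, replacing `r - s` by `T` makes the final constant independent of `s`.
      have h2 : C * ε * (r - s) ≤ C * ε * T :=
        mul_le_mul_of_nonneg_left (by linarith [hr.2]) (by positivity)
      rw [h.eq r hr]
      refine (norm_add_le _ _).trans ?_
      have h3 := ha r hr
      nlinarith [h1, h2, h3]) t ht
  refine key.trans ?_
  have hT : 0 ≤ T := hs.trans (ht.1.trans ht.2)
  have : t - s ≤ T := by linarith [ht.2]
  gcongr

end IsConvolution

/-- Solutions of the Volterra equation `y t = a t + ∫ₛᵗ W (t - τ) F_τ(y τ) dτ` on `[s, T]`. -/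
structure IsVolterraSolution (W : ℝ → X →L[ℝ] X) (F : ℝ → X → X) (s T : ℝ) (a y : ℝ → X) :
    Prop where
  continuousOn : ContinuousOn y (Icc s T)
  eq : ∀ t ∈ Icc s T, y t = a t + ∫ τ in s..t, W (t - τ) (F τ (y τ))

namespace IsVolterraSolution

variable {W : ℝ → X →L[ℝ] X} {F : ℝ → X → X} {C L s T δ : ℝ} {a a₁ a₂ y y₁ y₂ : ℝ → X}

/-- Differences of solutions do not solve the same nonlinear equation, but they are still
convolutions, and Grönwall's inequality needs no more. -/
lemma isConvolution (h : IsVolterraSolution W F s T a y) (hF : IsCaratheodory F (Icc s T) L) :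
    IsConvolution W s T a (fun τ => F τ (y τ)) y :=
  ⟨h.continuousOn, hF.integrableOn_comp h.continuousOn, h.eq⟩

lemma norm_le (hW : IsStrongFamily W C) (hF : IsCaratheodory F (Icc s T) L) (hs : 0 ≤ s)
    (h : IsVolterraSolution W F s T a y) (ha : ∀ t ∈ Icc s T, ‖a t‖ ≤ δ) :
    ∀ t ∈ Icc s T, ‖y t‖ ≤ (δ + C * L * T) * Real.exp (C * L * T) := by
  refine (h.isConvolution hF).norm_le hW hs hF.nonneg hF.nonneg ha ?_
  filter_upwards [hF.norm_le] with t ht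
  exact ht _

lemma norm_sub_le (hW : IsStrongFamily W C) (hF : IsCaratheodory F (Icc s T) L) (hs : 0 ≤ s)
    (h₁ : IsVolterraSolution W F s T a₁ y₁) (h₂ : IsVolterraSolution W F s T a₂ y₂)
    (ha : ∀ t ∈ Icc s T, ‖a₁ t - a₂ t‖ ≤ δ) :
    ∀ t ∈ Icc s T, ‖y₁ t - y₂ t‖ ≤ δ * Real.exp (C * L * T) := by
  have := ((h₁.isConvolution hF).sub hW (h₂.isConvolution hF)).norm_le hW hs hF.nonneg le_rfl ha
    (by
      filter_upwards [hF.lipschitz] with t ht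
      simpa using ht _ _)
  simpa using this

lemma eqOn (hW : IsStrongFamily W C) (hF : IsCaratheodory F (Icc s T) L) (hs : 0 ≤ s)
    (h₁ : IsVolterraSolution W F s T a y₁) (h₂ : IsVolterraSolution W F s T a y₂) :
    EqOn y₁ y₂ (Icc s T) := fun t ht => by
  have := h₁.norm_sub_le (δ := 0) hW hF hs h₂ (by simp) t ht
  rw [zero_mul, norm_le_zero_iff] at this
  exact sub_eq_zero.1 this

end IsVolterraSolution

open Nat in
/-- Picard iteration for Volterra equations. -/
theorem exists_isVolterraSolution [CompleteSpace X] {W : ℝ → X →L[ℝ] X} {F : ℝ → X → X}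
    {C L s T : ℝ} {a : ℝ → X} (hW : IsStrongFamily W C) (hF : IsCaratheodory F (Icc s T) L)
    (hsT : s ≤ T) (ha : ContinuousOn a (Icc s T)) :
    ∃ y, IsVolterraSolution W F s T a y := by
  have hC := hW.nonneg
  have hL := hF.nonneg
  have hext : ∀ y : C(Icc s T, X), ContinuousOn (IccExtend hsT y) (Icc s T) := fun y =>
    y.continuous.Icc_extend'.continuousOn
  have hint := fun y : C(Icc s T, X) => hF.integrableOn_comp (hext y)
  let Γ : C(Icc s T, X) → C(Icc s T, X) := fun y =>
    ⟨(Icc s T).domRestrict fun t => a t + ∫ τ in s..t, W (t - τ) (F τ (IccExtend hsT y τ)),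
      (ha.add (hW.continuousOn_conv (hint y))).domRestrict⟩
  have hΓ : ∀ y (t : Icc s T),
      Γ y t = a t + ∫ τ in s..t, W (t - τ) (F τ (IccExtend hsT y τ)) := fun y t => rfl
  -- The factorial makes some iterate a contraction in the sup metric on all of `[s, T]`, with no
  -- smallness of the interval; its fixed point is also fixed by `Γ`.
  have hiter : ∀ (n : ℕ) (y z : C(Icc s T, X)) (t : Icc s T),
      ‖Γ^[n] y t - Γ^[n] z t‖ ≤ (C * L * (t - s)) ^ n / n ! * dist y z := by
    intro n y z
    induction n with
    | zero => intro t; simpa [dist_eq_norm] using (y - z).norm_coe_le_norm t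
    | succ n ih =>
      intro t
      have hs : s ∈ Icc s T := ⟨le_rfl, hsT⟩
      rw [Function.iterate_succ_apply', Function.iterate_succ_apply', hΓ, hΓ,
        add_sub_add_left_eq_sub, ← intervalIntegral.integral_sub
          (hW.intervalIntegrable_conv (hint _) hs t.2 t)
          (hW.intervalIntegrable_conv (hint _) hs t.2 t)]
      simp only [← map_sub]
      refine (hW.norm_conv_le t.2.1
        (ρ := fun τ => L * ((C * L * (τ - s)) ^ n / n ! * dist y z))
        (Continuous.intervalIntegrable (by fun_prop) _ _) ?_).trans (le_of_eq ?_)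
      · have hsub : Icc s t.1 ⊆ Icc s T := Icc_subset_Icc_right t.2.2
        filter_upwards [ae_restrict_of_ae_restrict_of_subset hsub hF.lipschitz,
          ae_restrict_mem measurableSet_Icc] with τ hτ hm
        refine (hτ _ _).trans (mul_le_mul_of_nonneg_left ?_ hL)
        rw [IccExtend_of_mem hsT _ (hsub hm), IccExtend_of_mem hsT _ (hsub hm)]
        exact ih ⟨τ, hsub hm⟩
      · have e : ∀ τ : ℝ, L * ((C * L * (τ - s)) ^ n / n ! * dist y z)
            = (L * (C * L) ^ n / n ! * dist y z) * (τ - s) ^ n := fun τ => by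
          rw [mul_pow]; ring
        simp only [e]
        rw [intervalIntegral.integral_const_mul,
          intervalIntegral.integral_comp_sub_right (fun τ => τ ^ n), integral_pow]
        rw [Nat.factorial_succ]
        push_cast
        have : (n ! : ℝ) ≠ 0 := by positivity
        have : (n + 1 : ℝ) ≠ 0 := by positivity
        simp only [sub_self, ne_eq, Nat.add_eq_zero_iff, one_ne_zero, and_false, not_false_eq_true,
          zero_pow, sub_zero]
        field_simp
        rw [mul_pow (C * L)]
        ring
  obtain ⟨n, hn⟩ := (FloorSemiring.tendsto_pow_div_factorial_atTop (C * L * (T - s))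
    |>.eventually (gt_mem_nhds zero_lt_one)).exists
  have hnn : 0 ≤ (C * L * (T - s)) ^ n / n ! := by
    have := sub_nonneg.2 hsT
    positivity
  have hcontr : ContractingWith ⟨_, hnn⟩ Γ^[n] := by
    refine ⟨hn, LipschitzWith.of_dist_le_mul fun y z => ?_⟩
    refine (ContinuousMap.dist_le (by positivity)).2 fun t => ?_
    rw [dist_eq_norm]
    refine (hiter n y z t).trans ?_
    have h1 : 0 ≤ t.1 - s := sub_nonneg.2 t.2.1
    have h2 : t.1 ≤ T := t.2.2
    change _ ≤ (C * L * (T - s)) ^ n / n ! * dist y z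
    gcongr
  obtain ⟨y, hy⟩ : ∃ y, Γ y = y := ⟨_, hcontr.isFixedPt_fixedPoint_iterate⟩
  refine ⟨IccExtend hsT y, hext y, fun t ht => ?_⟩
  rw [← hΓ y ⟨t, ht⟩, hy, IccExtend_of_mem hsT _ ht]

end Volterra

/-! ### Differentiability in the initial state, restarting, truncation of the semigroup -/

section Flow

variable {X : Type*} [NormedAddCommGroup X] [NormedSpace ℝ X]

/-- First-order Taylor estimate for a map with Lipschitz derivative. -/
lemma norm_sub_sub_fderiv_le {f : X → X} {f' : X → X →L[ℝ] X} {M : ℝ} (hM : 0 ≤ M)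
    (hf : ∀ x, HasFDerivAt f (f' x) x) (hL : ∀ x y, ‖f' x - f' y‖ ≤ M * ‖x - y‖) (a b : X) :
    ‖f b - f a - f' a (b - a)‖ ≤ M * ‖b - a‖ ^ 2 := by
  -- Mean value inequality on the ball of radius `‖b - a‖` about `a`, where the derivative stays
  -- within `M * ‖b - a‖` of `f' a`.
  have := (convex_closedBall a ‖b - a‖).norm_image_sub_le_of_norm_hasFDerivWithin_le'
    (f := f) (f' := f') (φ := f' a) (C := M * ‖b - a‖) (x := a) (y := b)
    (fun x _ => (hf x).hasFDerivWithinAt)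
    (fun x hx => (hL x a).trans <| by
      rw [Metric.mem_closedBall, dist_eq_norm] at hx
      gcongr)
    (by simp) (by simp [dist_eq_norm])
  rwa [mul_assoc, ← sq] at this

/-- The solution of a Volterra equation depends differentiably on the initial state. -/
theorem IsVolterraSolution.differentiable [CompleteSpace X] {W : ℝ → X →L[ℝ] X} {C L M s T : ℝ}
    {F : ℝ → X → X} {DF : ℝ → X → X →L[ℝ] X} {Y : X → ℝ → X} (hW : IsStrongFamily W C)
    (hF : IsCaratheodory F (Icc s T) L) (hs : 0 ≤ s) (hM : 0 ≤ M)
    (hD : ∀ᵐ t ∂(volume.restrict (Icc s T)), ∀ x, HasFDerivAt (F t) (DF t x) x)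
    (hDm : ∀ x, AEStronglyMeasurable (fun t => DF t x) (volume.restrict (Icc s T)))
    (hDL : ∀ᵐ t ∂(volume.restrict (Icc s T)), ∀ x y, ‖DF t x - DF t y‖ ≤ M * ‖x - y‖)
    (hY : ∀ x, IsVolterraSolution W F s T (fun t => W (t - s) x) (Y x))
    {t : ℝ} (ht : t ∈ Icc s T) : Differentiable ℝ fun x => Y x t := by
  intro x
  have hC := hW.nonneg
  have hL := hF.nonneg
  have hT : 0 ≤ T := hs.trans (ht.1.trans ht.2)
  have hDc : ∀ᵐ t ∂(volume.restrict (Icc s T)), Continuous (DF t) := by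
    filter_upwards [hDL] with r hr
    exact (LipschitzWith.of_dist_le_mul (K := ⟨M, hM⟩) fun x y => by
      simpa [dist_eq_norm] using! hr x y).continuous
  have hDn : ∀ᵐ t ∂(volume.restrict (Icc s T)), ∀ x, ‖DF t x‖ ≤ L := by
    filter_upwards [hD, hF.lipschitz] with r hr hr' z
    exact (hr z).le_of_lipschitz (C := ⟨L, hL⟩) (LipschitzWith.of_dist_le_mul fun x y => by
      simpa [dist_eq_norm] using! hr' x y)
  -- The equation linearised along `Y x` is again of Volterra type. Its solution `Z h` is the
  -- candidate derivative in direction `h`; linearity in `h` follows from uniqueness.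
  have hB : IsCaratheodory (fun τ w => DF τ (Y x τ) w) (Icc s T) L := by
    refine ⟨hL, fun w => ?_, ?_, by simp [hL]⟩
    · exact (aestronglyMeasurable_superposition hDm hDc
        ((hY x).continuousOn.aestronglyMeasurable_of_isCompact isCompact_Icc
          measurableSet_Icc)).apply_continuousLinearMap w
    · filter_upwards [hDn] with r hr v w
      rw [← map_sub]
      exact (DF r (Y x r)).le_of_opNorm_le (hr _) _
  choose Z hZ using fun h : X => exists_isVolterraSolution (a := fun t => W (t - s) h) hW hB
    (ht.1.trans ht.2) ((hW.continuous_orbit h).comp (continuous_id.sub continuous_const)).continuousOn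
  have hadd : ∀ h k, Z (h + k) t = Z h t + Z k t := fun h k => by
    have h1 := ((hZ h).isConvolution hB).add hW ((hZ k).isConvolution hB)
    have h2 : IsVolterraSolution W (fun τ w => DF τ (Y x τ) w) s T
        (fun t => W (t - s) (h + k)) (fun t => Z h t + Z k t) :=
      ⟨h1.continuousOn, by simpa only [map_add] using h1.eq⟩
    exact (hZ (h + k)).eqOn hW hB hs h2 ht
  have hsmul : ∀ (c : ℝ) h, Z (c • h) t = c • Z h t := fun c h => by
    have h1 := ((hZ h).isConvolution hB).const_smul c
    have h2 : IsVolterraSolution W (fun τ w => DF τ (Y x τ) w) s T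
        (fun t => W (t - s) (c • h)) (fun t => c • Z h t) :=
      ⟨h1.continuousOn, by simpa only [map_smul] using h1.eq⟩
    exact (hZ (c • h)).eqOn hW hB hs h2 ht
  have hZn : ∀ h, ‖Z h t‖ ≤ C * Real.exp (C * L * T) * ‖h‖ := fun h => by
    have := ((hZ h).isConvolution hB).norm_le hW (δ := C * ‖h‖) (ε := 0) hs hL le_rfl
      (fun r _ => hW.norm_apply_le _ _) (by
        filter_upwards [hDn] with r hr
        simpa using (DF r (Y x r)).le_of_opNorm_le (hr _) _) t ht
    calc _ ≤ _ := this
      _ = _ := by ring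
  let D : X →L[ℝ] X := LinearMap.mkContinuous ⟨⟨fun h => Z h t, hadd⟩, hsmul⟩ _ hZn
  refine ⟨D, ?_⟩
  -- `K` is the Lipschitz constant of the flow in the initial state.
  set K := C * Real.exp (C * L * T) with hK
  have hrem : ∀ h, ‖Y (x + h) t - Y x t - D h‖
      ≤ C * (M * K ^ 2) * T * Real.exp (C * L * T) * ‖h‖ ^ 2 := fun h => by
    have h1 := (((hY (x + h)).isConvolution hF).sub hW ((hY x).isConvolution hF)).sub hW
      ((hZ h).isConvolution hB)
    have hd := (hY (x + h)).norm_sub_le hW hF hs (hY x) (δ := C * ‖h‖) (fun r _ => by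
      rw [← map_sub]
      simpa using hW.norm_apply_le (r - s) h)
    have h2 := h1.norm_le hW (δ := 0) (L := L) (ε := M * (K * ‖h‖) ^ 2) hs hL (by positivity)
      (by simp) (by
        filter_upwards [hD, hDL, hDn, ae_restrict_mem measurableSet_Icc] with r h3 h4 h5 hr
        have h6 := norm_sub_sub_fderiv_le hM h3 h4 (Y x r) (Y (x + h) r)
        have h7 := (DF r (Y x r)).le_of_opNorm_le (h5 _) (Y (x + h) r - Y x r - Z h r)
        have h8 : ‖Y (x + h) r - Y x r‖ ≤ K * ‖h‖ := (hd r hr).trans_eq (by rw [hK]; ring)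
        have h9 : M * ‖Y (x + h) r - Y x r‖ ^ 2 ≤ M * (K * ‖h‖) ^ 2 := by gcongr
        -- The remainder satisfies the linearised equation with zero initial term, up to a Taylor
        -- error of order `‖h‖ ^ 2`; Grönwall then bounds it by the same order.
        have h10 : F r (Y (x + h) r) - F r (Y x r) - DF r (Y x r) (Z h r)
          = DF r (Y x r) (Y (x + h) r - Y x r - Z h r)
            + (F r (Y (x + h) r) - F r (Y x r) - DF r (Y x r) (Y (x + h) r - Y x r)) := by
          simp only [map_sub]; abel
        rw [h10]
        exact (norm_add_le _ _).trans (add_le_add h7 (h6.trans h9))) t ht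
    calc _ ≤ _ := h2
      _ = _ := by ring
  rw [hasFDerivAt_iff_isLittleO_nhds_zero]
  have hO : (fun h => Y (x + h) t - Y x t - D h) =O[𝓝 0] fun h : X => ‖h‖ ^ 2 :=
    Asymptotics.IsBigO.of_bound (C * (M * K ^ 2) * T * Real.exp (C * L * T))
      (Eventually.of_forall fun h => by simpa using hrem h)
  exact hO.trans_isLittleO (Asymptotics.isLittleO_norm_pow_id one_lt_two)

/-- Restarting a solution of the Volterra equation at a later time. -/
theorem IsVolterraSolution.restart [CompleteSpace X] {W : ℝ → X →L[ℝ] X} {C L s r T : ℝ}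
    {F : ℝ → X → X} {y : ℝ → X} {x : X} (hW : IsStrongFamily W C)
    (hadd : ∀ p q, 0 ≤ p → 0 ≤ q → p + q ≤ T → W (p + q) = (W p).comp (W q))
    (hF : IsCaratheodory F (Icc s T) L) (hs : 0 ≤ s) (hr : r ∈ Icc s T)
    (h : IsVolterraSolution W F s T (fun t => W (t - s) x) y) :
    IsVolterraSolution W F r T (fun t => W (t - r) (y r)) y where
  continuousOn := h.continuousOn.mono (Icc_subset_Icc_left hr.1)
  eq t ht := by
    have ht' : t ∈ Icc s T := ⟨hr.1.trans ht.1, ht.2⟩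
    have hs' : s ∈ Icc s T := ⟨le_rfl, hr.1.trans hr.2⟩
    have hi := (h.isConvolution hF).integrableOn
    -- The semigroup law is invoked only for total time `t - τ ≤ T`, the range in which a truncated
    -- semigroup still obeys it.
    have hcomp : ∀ τ ∈ Icc s r, ∀ z, W (t - r) (W (r - τ) z) = W (t - τ) z := fun τ hτ z => by
      have := hadd (t - r) (r - τ) (by linarith [ht.1]) (by linarith [hτ.2])
        (by linarith [ht.2, hτ.1])
      rw [show t - τ = t - r + (r - τ) by ring, this]
      rfl
    rw [h.eq t ht', h.eq r hr, map_add, hcomp s ⟨le_rfl, hr.1⟩,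
      ← intervalIntegral.integral_add_adjacent_intervals
        (hW.intervalIntegrable_conv hi hs' hr t) (hW.intervalIntegrable_conv hi hr ht' t),
      ← ContinuousLinearMap.intervalIntegral_comp_comm _ (hW.intervalIntegrable_conv hi hs' hr r),
      ← add_assoc]
    congr 2
    refine intervalIntegral.integral_congr fun τ hτ => ?_
    rw [uIcc_of_le hr.1] at hτ
    exact (hcomp τ hτ _).symm

/-- The truncation of a `C₀`-semigroup to `[0, T]`, extended by constants. -/
lemma IsC0Semigroup.exists_isStrongFamily [CompleteSpace X] {S : ℝ → X →L[ℝ] X}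
    (hS : IsC0Semigroup S) (T : ℝ) :
    ∃ C, IsStrongFamily (fun r => S (max 0 (min r T))) C := by
  have hc : ∀ x, Continuous fun r => S (max 0 (min r T)) x := fun x =>
    (hS.continuousOn_orbit x).comp_continuous (by fun_prop) fun r => mem_Ici.2 (le_max_left _ _)
  -- Each orbit is bounded, being continuous on a compact interval; uniform boundedness gives one
  -- constant.
  obtain ⟨C, hC⟩ := banach_steinhaus (g := fun r => S (max 0 (min r T))) fun x => by
    obtain ⟨c, hc'⟩ := isCompact_Icc.exists_bound_of_continuousOn (s := Icc 0 (max 0 T))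
      ((hS.continuousOn_orbit x).mono Icc_subset_Ici_self)
    exact ⟨c, fun r => hc' _ ⟨le_max_left _ _, max_le_max le_rfl (min_le_right _ _)⟩⟩
  exact ⟨C, hc, hC⟩

end Flow

/-! ### A trajectory against the flow of another field -/

section Comparison

variable {X : Type*} [NormedAddCommGroup X] [NormedSpace ℝ X]

/-- A trajectory `x` of the field `F` together with the evolution maps `Φ` of another field
`F'`. -/
structure IsPerturbedEvolution (W : ℝ → X →L[ℝ] X) (C L T : ℝ) (F F' : ℝ → X → X) (x₀ : X)
    (x : ℝ → X) (Φ : ℝ → X → ℝ → X) : Prop where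
  family : IsStrongFamily W C
  map_zero : W 0 = ContinuousLinearMap.id ℝ X
  map_add : ∀ p q, 0 ≤ p → 0 ≤ q → p + q ≤ T → W (p + q) = (W p).comp (W q)
  field : IsCaratheodory F (Icc 0 T) L
  field' : IsCaratheodory F' (Icc 0 T) L
  trajectory : IsVolterraSolution W F 0 T (fun t => W (t - 0) x₀) x
  evolution : ∀ s ∈ Icc 0 T, ∀ z, IsVolterraSolution W F' s T (fun t => W (t - s) z) (Φ s z)

namespace IsPerturbedEvolution

variable {W : ℝ → X →L[ℝ] X} {C L T : ℝ} {F F' : ℝ → X → X} {x₀ : X} {x : ℝ → X}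
  {Φ : ℝ → X → ℝ → X} {r t : ℝ}

lemma evolution_self (h : IsPerturbedEvolution W C L T F F' x₀ x Φ) (ht : t ∈ Icc 0 T) (z : X) :
    Φ t z t = z := by
  rw [(h.evolution t ht z).eq t ⟨le_rfl, ht.2⟩]
  simp [h.map_zero]

/-- Uniqueness identifies the restarted solution with the evolution. This flow property lets the
cost seen from time `r` be evaluated through the later time `t`. -/
lemma evolution_comp [CompleteSpace X] (h : IsPerturbedEvolution W C L T F F' x₀ x Φ)
    (hr : r ∈ Icc 0 T) (ht : t ∈ Icc r T) (z : X) : Φ t (Φ r z t) T = Φ r z T := by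
  have hFr := h.field'.mono (Icc_subset_Icc_left hr.1)
  have ht0 : 0 ≤ t := hr.1.trans ht.1
  have h1 := (h.evolution r hr z).restart h.family h.map_add hFr hr.1 ht
  exact (h.evolution t ⟨ht0, ht.2⟩ _).eqOn h.family (hFr.mono (Icc_subset_Icc_left ht.1)) ht0 h1
    ⟨ht.2, le_rfl⟩

/-- One ball contains all the curves, so that a single local Lipschitz constant of `ℓ` serves. -/
lemma exists_norm_le (h : IsPerturbedEvolution W C L T F F' x₀ x Φ) :
    ∃ R, 0 ≤ R ∧ (∀ t ∈ Icc 0 T, ‖x t‖ ≤ R) ∧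
      ∀ r ∈ Icc 0 T, ∀ t ∈ Icc r T, ‖Φ r (x r) t‖ ≤ R := by
  obtain ⟨R, hR⟩ := isCompact_Icc.exists_bound_of_continuousOn h.trajectory.continuousOn
  refine ⟨max (max 0 R) ((C * R + C * L * T) * Real.exp (C * L * T)),
    (le_max_left _ _).trans (le_max_left _ _),
    fun t ht => (hR t ht).trans ((le_max_right _ _).trans (le_max_left _ _)), fun r hr t ht => ?_⟩
  refine ((h.evolution r hr (x r)).norm_le h.family
    (h.field'.mono (Icc_subset_Icc_left hr.1)) hr.1 (fun τ _ => ?_) t ht).trans (le_max_right _ _)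
  exact (h.family.norm_apply_le _ _).trans
    (mul_le_mul_of_nonneg_left (hR r hr) h.family.nonneg)

/-- The defect between the trajectory and the evolution restarted on it. -/
lemma sub_evolution_eq [CompleteSpace X] (h : IsPerturbedEvolution W C L T F F' x₀ x Φ)
    (hr : r ∈ Icc 0 T) (ht : t ∈ Icc r T) :
    x t - Φ r (x r) t = ∫ τ in r..t, W (t - τ) (F τ (x τ) - F' τ (Φ r (x r) τ)) := by
  have hsub := Icc_subset_Icc_left (b := T) hr.1
  have h1 := ((h.trajectory.restart h.family h.map_add h.field le_rfl hr).isConvolution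
    (h.field.mono hsub)).sub h.family ((h.evolution r hr (x r)).isConvolution (h.field'.mono hsub))
  simpa using h1.eq t ht

/-- The integrand of the defect is bounded, by linear growth on the common ball. -/
lemma exists_norm_sub_evolution_le [CompleteSpace X]
    (h : IsPerturbedEvolution W C L T F F' x₀ x Φ) :
    ∃ Q, 0 ≤ Q ∧ ∀ r ∈ Icc 0 T, ∀ t ∈ Icc r T, ‖x t - Φ r (x r) t‖ ≤ Q * (t - r) := by
  obtain ⟨R, hR, hx, hΦ⟩ := h.exists_norm_le
  have hL := h.field.nonneg
  have hC := h.family.nonneg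
  refine ⟨C * ((L * R + L) + (L * R + L)), by positivity, fun r hr t ht => ?_⟩
  rw [h.sub_evolution_eq hr ht]
  refine h.family.norm_conv_le_const ht.1 ?_
  have hsub : Icc r t ⊆ Icc 0 T := Icc_subset_Icc hr.1 ht.2
  filter_upwards [ae_restrict_of_ae_restrict_of_subset hsub h.field.norm_le,
    ae_restrict_of_ae_restrict_of_subset hsub h.field'.norm_le,
    ae_restrict_mem measurableSet_Icc] with τ h1 h2 hτ
  refine (norm_sub_le _ _).trans (add_le_add ((h1 _).trans ?_) ((h2 _).trans ?_))
  · have := hx τ (hsub hτ)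
    gcongr
  · have := hΦ r hr τ ⟨hτ.1, hτ.2.trans ht.2⟩
    gcongr

/-- At almost every time, the evolution restarted along the trajectory is left differentiable in
the restarting time. -/
theorem ae_hasDerivWithinAt_evolution [CompleteSpace X]
    (h : IsPerturbedEvolution W C L T F F' x₀ x Φ) :
    ∀ᵐ t ∂(volume.restrict (Icc 0 T)),
      HasDerivWithinAt (fun r => Φ r (x r) t) (F t (x t) - F' t (x t)) (Icc 0 t) t := by
  obtain ⟨Q, hQ, hdef⟩ := h.exists_norm_sub_evolution_le
  have hC := h.family.nonneg
  have hL := h.field.nonneg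
  set k : ℝ → X := (Icc 0 T).indicator fun τ => F τ (x τ) - F' τ (x τ) with hk
  have hki : Integrable k :=
    ((h.field.integrableOn_comp h.trajectory.continuousOn).sub
      (h.field'.integrableOn_comp h.trajectory.continuousOn)).integrable_indicator
        measurableSet_Icc
  have hkeq : ∀ τ ∈ Icc 0 T, k τ = F τ (x τ) - F' τ (x τ) := fun τ hτ => indicator_of_mem hτ _
  filter_upwards [ae_restrict_mem measurableSet_Icc, ae_restrict_of_ae
    (IsUnifLocDoublingMeasure.ae_tendsto_average_norm_sub volume hki.locallyIntegrable 1)]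
    with t ht hleb
  rw [hasDerivWithinAt_iff_tendsto_slope, tendsto_iff_norm_sub_tendsto_zero]
  set l := 𝓝[Icc 0 t \ {t}] t with hl
  have hlt : ∀ᶠ r in l, r ∈ Icc 0 t ∧ r < t := by
    filter_upwards [self_mem_nhdsWithin] with r hr
    exact ⟨hr.1, lt_of_le_of_ne hr.1.2 hr.2⟩
  have hlid : Tendsto (fun r => r) l (𝓝 t) := tendsto_id.mono_right nhdsWithin_le_nhds
  have hlsub : Tendsto (fun r => t - r) l (𝓝 0) := by
    simpa using (tendsto_const_nhds (x := t)).sub hlid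
  -- Lebesgue differentiation with `[r, t]` seen as the ball about `(r + t) / 2` of radius `(t - r)
  -- / 2`: the point `t` lies on the boundary, so the centres move with `r`.
  have A : Tendsto (fun r => (t - r)⁻¹ * ∫ τ in r..t, ‖k τ - k t‖) l (𝓝 0) := by
    refine (hleb (l := l) (fun r => (r + t) / 2) (fun r => (t - r) / 2) ?_ ?_).congr' ?_
    · refine tendsto_nhdsWithin_iff.2 ⟨by simpa using hlsub.div_const 2, ?_⟩
      filter_upwards [hlt] with r hr
      exact half_pos (sub_pos.2 hr.2)
    · filter_upwards [hlt] with r hr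
      rw [Metric.mem_closedBall, Real.dist_eq, one_mul,
        show t - (r + t) / 2 = (t - r) / 2 by ring, abs_of_nonneg]
      linarith [hr.2]
    · filter_upwards [hlt] with r hr
      rw [← Real.Icc_eq_closedBall, setAverage_eq, intervalIntegral.integral_of_le hr.2.le,
        integral_Icc_eq_integral_Ioc]
      simp [Measure.real, hr.2.le]
  -- Strong continuity at time `0`, applied to the frozen vector `k t`: the integrand vanishes at `τ
  -- = t`.
  have B : Tendsto (fun r => (t - r)⁻¹ * ∫ τ in r..t, ‖W (t - τ) (k t) - k t‖) l (𝓝 0) := by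
    have hc : Continuous fun τ => ‖W (t - τ) (k t) - k t‖ :=
      (((h.family.continuous_orbit (k t)).comp (continuous_const.sub continuous_id)).sub
        continuous_const).norm
    have hd : HasDerivAt (fun r => ∫ τ in t..r, ‖W (t - τ) (k t) - k t‖) 0 t := by
      have := intervalIntegral.integral_hasDerivAt_right (hc.intervalIntegrable t t)
        hc.aestronglyMeasurable.stronglyMeasurableAtFilter hc.continuousAt
      simpa [h.map_zero] using this
    refine (hasDerivWithinAt_iff_tendsto_slope.1 hd.hasDerivWithinAt).congr fun r => ?_
    rw [slope_def_field, intervalIntegral.integral_same, sub_zero,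
      intervalIntegral.integral_symm r t, div_eq_inv_mul, ← neg_sub t r, inv_neg, neg_mul_neg]
  have key := ((A.const_mul C).add B).add (hlsub.const_mul (C * (L * Q)))
  simp only [mul_zero, add_zero] at key
  refine squeeze_zero' (Eventually.of_forall fun _ => norm_nonneg _) ?_ key
  filter_upwards [hlt] with r ⟨hr, hrt⟩
  have hr' : r ∈ Icc 0 T := ⟨hr.1, hr.2.trans ht.2⟩
  have ht' : t ∈ Icc r T := ⟨hr.2, ht.2⟩
  have hsub : Icc r t ⊆ Icc 0 T := Icc_subset_Icc hr.1 ht.2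
  have hpos : 0 < t - r := sub_pos.2 hrt
  have hrm : r ∈ Icc r T := ⟨le_rfl, hr'.2⟩
  have hψ : IntegrableOn (fun τ => F τ (x τ) - F' τ (Φ r (x r) τ)) (Icc r T) :=
    have hsubr := Icc_subset_Icc_left (b := T) hr.1
    ((h.field.mono hsubr).integrableOn_comp (h.trajectory.continuousOn.mono hsubr)).sub
      ((h.field'.mono hsubr).integrableOn_comp (h.evolution r hr' (x r)).continuousOn)
  have hslope : slope (fun r => Φ r (x r) t) t r - (F t (x t) - F' t (x t))
      = (t - r)⁻¹ • ∫ τ in r..t, (W (t - τ) (F τ (x τ) - F' τ (Φ r (x r) τ)) - k t) := by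
    rw [intervalIntegral.integral_sub (h.family.intervalIntegrable_conv hψ hrm ht' t) (by simp),
      ← h.sub_evolution_eq hr' ht', intervalIntegral.integral_const, smul_sub, smul_smul,
      inv_mul_cancel₀ hpos.ne', one_smul, hkeq t ht, slope_def_module,
      h.evolution_self ht, ← neg_sub t r, inv_neg, neg_smul, ← smul_neg, neg_sub]
  have i1 : IntervalIntegrable (fun τ => ‖k τ - k t‖) volume r t :=
    (hki.intervalIntegrable.sub (by simp)).norm
  have i2 : IntervalIntegrable (fun τ => ‖W (t - τ) (k t) - k t‖) volume r t :=
    Continuous.intervalIntegrable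
      (((h.family.continuous_orbit (k t)).comp (continuous_const.sub continuous_id)).sub
        continuous_const).norm _ _
  have hbound : ‖∫ τ in r..t, (W (t - τ) (F τ (x τ) - F' τ (Φ r (x r) τ)) - k t)‖
      ≤ ∫ τ in r..t, (C * ‖k τ - k t‖ + ‖W (t - τ) (k t) - k t‖ + C * (L * (Q * (t - r)))) := by
    refine intervalIntegral.norm_integral_le_of_norm_le hr.2 ?_
      (((i1.const_mul C).add i2).add (by simp))
    have h1 := ae_restrict_of_ae_restrict_of_subset hsub h.field'.lipschitz
    rw [ae_restrict_iff' measurableSet_Icc] at h1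
    filter_upwards [h1] with τ hτ hm
    have hm' : τ ∈ Icc r t := Ioc_subset_Icc_self hm
    -- Three errors: oscillation of `k` near `t`, the semigroup acting on `k t`, and the defect
    -- between the curves, which is of order `t - r`.
    have e : W (t - τ) (F τ (x τ) - F' τ (Φ r (x r) τ)) - k t
        = W (t - τ) (k τ - k t) + (W (t - τ) (k t) - k t)
          + W (t - τ) (F' τ (x τ) - F' τ (Φ r (x r) τ)) := by
      rw [hkeq τ (hsub hm')]
      simp only [map_sub]
      abel
    rw [e]
    refine (norm_add₃_le).trans (add_le_add (add_le_add (h.family.norm_apply_le _ _) le_rfl)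
      ((h.family.norm_apply_le _ _).trans (mul_le_mul_of_nonneg_left ((hτ hm' _ _).trans
        (mul_le_mul_of_nonneg_left ?_ hL)) hC)))
    refine (hdef r hr' τ ⟨hm'.1, hm'.2.trans ht.2⟩).trans ?_
    have := hm'.2
    gcongr
  rw [intervalIntegral.integral_add ((i1.const_mul C).add i2) (by simp),
    intervalIntegral.integral_add (i1.const_mul C) i2, intervalIntegral.integral_const_mul,
    intervalIntegral.integral_const, smul_eq_mul] at hbound
  rw [hslope, norm_smul, norm_inv, Real.norm_of_nonneg hpos.le]
  refine (mul_le_mul_of_nonneg_left hbound (inv_nonneg.2 hpos.le)).trans (le_of_eq ?_)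
  field_simp

/-- The terminal cost propagated by the evolution is Lipschitz along the trajectory. -/
theorem exists_lipschitzOnWith_cost [CompleteSpace X]
    (h : IsPerturbedEvolution W C L T F F' x₀ x Φ) {ℓ : X → ℝ}
    (hℓ : ∀ B : Set X, Bornology.IsBounded B → ∃ K : ℝ≥0, LipschitzOnWith K ℓ B) :
    ∃ K : ℝ≥0, LipschitzOnWith K (fun t => ℓ (Φ t (x t) T)) (Icc 0 T) := by
  obtain ⟨R, hR, hx, hΦ⟩ := h.exists_norm_le
  obtain ⟨Q, hQ, hdef⟩ := h.exists_norm_sub_evolution_le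
  obtain ⟨K, hK⟩ := hℓ _ (Metric.isBounded_closedBall (x := (0 : X)) (r := R))
  have hC := h.family.nonneg
  have hL := h.field.nonneg
  refine ⟨K * Real.toNNReal (C * Q * Real.exp (C * L * T)), LipschitzOnWith.of_dist_le_mul ?_⟩
  have hE : 0 ≤ C * Q * Real.exp (C * L * T) := by positivity
  have key : ∀ r ∈ Icc 0 T, ∀ t ∈ Icc 0 T, r ≤ t →
      dist (ℓ (Φ r (x r) T)) (ℓ (Φ t (x t) T)) ≤
        (K * Real.toNNReal (C * Q * Real.exp (C * L * T)) : ℝ≥0) * dist r t := by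
    intro r hr t ht hrt
    have hTr : T ∈ Icc r T := ⟨hr.2, le_rfl⟩
    have hTt : T ∈ Icc t T := ⟨ht.2, le_rfl⟩
    refine (hK.dist_le_mul _ (by simpa using hΦ r hr T hTr) _
      (by simpa using hΦ t ht T hTt)).trans ?_
    rw [NNReal.coe_mul, mul_assoc, Real.coe_toNNReal _ hE]
    refine mul_le_mul_of_nonneg_left ?_ K.2
    -- Both terminal states now start at time `t`, from `Φ r (x r) t` and `x t`, which differ by at
    -- most `Q * (t - r)`.
    rw [← h.evolution_comp hr ⟨hrt, ht.2⟩, dist_comm, dist_eq_norm, dist_comm r t, Real.dist_eq,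
      abs_of_nonneg (sub_nonneg.2 hrt)]
    have h1 := (h.evolution t ht (x t)).norm_sub_le h.family
      (h.field'.mono (Icc_subset_Icc_left ht.1)) ht.1 (h.evolution t ht (Φ r (x r) t))
      (δ := C * (Q * (t - r))) (fun τ _ => by
        rw [← map_sub]
        exact (h.family.norm_apply_le _ _).trans
          (mul_le_mul_of_nonneg_left (hdef r hr t ⟨hrt, ht.2⟩) hC)) T hTt
    calc _ ≤ _ := h1
      _ = _ := by ring
  intro r hr t ht
  rcases le_total r t with hrt | hrt
  · exact key r hr t ht hrt
  · rw [dist_comm, dist_comm r t]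
    exact key t ht r hr hrt

/-- The derivative of the propagated terminal cost along the trajectory. -/
theorem ae_hasDerivAt_cost [CompleteSpace X] (h : IsPerturbedEvolution W C L T F F' x₀ x Φ)
    (hT : 0 ≤ T) {ℓ : X → ℝ}
    (hac : AbsolutelyContinuousOnInterval (fun t => ℓ (Φ t (x t) T)) 0 T)
    (hd : ∀ t ∈ Icc 0 T, Differentiable ℝ fun z => ℓ (Φ t z T)) :
    ∀ᵐ t ∂(volume.restrict (Icc 0 T)), HasDerivAt (fun t => ℓ (Φ t (x t) T))
      (fderiv ℝ (fun z => ℓ (Φ t z T)) (x t) (F t (x t) - F' t (x t))) t := by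
  -- Excluding `t = 0` keeps `[0, t]` nondegenerate, so that derivatives within it are unique at
  -- `t`.
  have h0 : ∀ᵐ t : ℝ, t ≠ 0 := by simp [ae_iff, measure_singleton]
  filter_upwards [ae_restrict_mem measurableSet_Icc, h.ae_hasDerivWithinAt_evolution,
    ae_restrict_of_ae hac.boundedVariationOn.ae_differentiableAt_of_mem_uIcc,
    ae_restrict_of_ae h0] with t ht hder hdiff ht0
  have htp : 0 < t := lt_of_le_of_ne ht.1 (Ne.symm ht0)
  have hg := (hdiff (by rwa [uIcc_of_le hT])).hasDerivAt
  have hc : HasDerivWithinAt (fun r => ℓ (Φ r (x r) T))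
      (fderiv ℝ (fun z => ℓ (Φ t z T)) (x t) (F t (x t) - F' t (x t))) (Icc 0 t) t := by
    have hp : HasFDerivAt (fun z => ℓ (Φ t z T)) (fderiv ℝ (fun z => ℓ (Φ t z T)) (x t))
        (Φ t (x t) t) := by
      rw [h.evolution_self ht]
      exact (hd t ht _).hasFDerivAt
    refine (hp.comp_hasDerivWithinAt (f := fun r => Φ r (x r) t) t hder).congr (fun r hr => ?_) ?_
    · exact congrArg ℓ (h.evolution_comp ⟨hr.1, hr.2.trans ht.2⟩ ⟨hr.2, ht.2⟩ (x r)).symm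
    · exact congrArg ℓ (h.evolution_comp ht ⟨le_rfl, ht.2⟩ (x t)).symm
  have hu : UniqueDiffWithinAt ℝ (Icc 0 t) t :=
    uniqueDiffOn_Icc htp t ⟨htp.le, le_rfl⟩
  rwa [hu.eq_deriv _ hg.hasDerivWithinAt hc] at hg

end IsPerturbedEvolution

end Comparison

/-! ### Controlled fields and mild solutions -/

section Control

variable {X : Type*} [NormedAddCommGroup X] [NormedSpace ℝ X] {m : ℕ}

lemma inner_adjointVec (L : EuclideanSpace ℝ (Fin m) →L[ℝ] X) (φ : X →L[ℝ] ℝ)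
    (v : EuclideanSpace ℝ (Fin m)) : inner ℝ v (adjointVec L φ) = φ (L v) := by
  rw [real_inner_comm, adjointVec, InnerProductSpace.toDual_symm_apply]
  rfl

lemma IsAdmissible.ae_norm_le {T R : ℝ} {U : Set (EuclideanSpace ℝ (Fin m))}
    {v : ℝ → EuclideanSpace ℝ (Fin m)} (hv : IsAdmissible T U v) (hR : ∀ w ∈ U, ‖w‖ ≤ R) :
    ∀ᵐ t ∂(volume.restrict (Icc 0 T)), ‖v t‖ ≤ R := by
  filter_upwards [hv.mem] with t ht
  exact hR _ ht

variable {T : ℝ} {f : ℝ → X → X} {G : ℝ → X → EuclideanSpace ℝ (Fin m) →L[ℝ] X}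

/-- The controlled fields are Carathéodory, with a constant independent of the control. -/
lemma AssumptionA.exists_isCaratheodory (hA : AssumptionA T f G) {R : ℝ} (hR : 0 ≤ R) :
    ∃ L, ∀ v : ℝ → EuclideanSpace ℝ (Fin m),
      AEStronglyMeasurable v (volume.restrict (Icc 0 T)) →
      (∀ᵐ t ∂(volume.restrict (Icc 0 T)), ‖v t‖ ≤ R) →
      IsCaratheodory (fun t x => field f G t x (v t)) (Icc 0 T) L := by
  obtain ⟨Mf, MG, hf, hG, hb⟩ := hA.bounds
  refine ⟨Mf + MG * R, fun v hv hvR => ⟨by positivity, fun x => ?_, ?_, ?_⟩⟩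
  · exact (hA.meas_f x).add (isBoundedBilinearMap_apply.continuous.comp_aestronglyMeasurable
      ((hA.meas_G x).prodMk hv))
  · filter_upwards [hb, hvR] with t ht htR x y
    have e : field f G t x (v t) - field f G t y (v t)
        = (f t x - f t y) + (G t x - G t y) (v t) := by
      simp only [field, sub_apply]; abel
    have h1 := (G t x - G t y).le_of_opNorm_le (ht.2.1 x y) (v t)
    have h2 : MG * ‖x - y‖ * ‖v t‖ ≤ MG * ‖x - y‖ * R := by gcongr
    rw [e]
    refine (norm_add_le _ _).trans ?_
    linarith [ht.1 x y]
  · filter_upwards [hb, hvR] with t ht htR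
    have h1 := (G t 0).le_of_opNorm_le ht.2.2.2 (v t)
    have h2 : MG * ‖v t‖ ≤ MG * R := by gcongr
    refine (norm_add_le _ _).trans ?_
    linarith [ht.2.2.1]

/-- The state derivative of the controlled field. -/
noncomputable def fieldDeriv (f : ℝ → X → X) (G : ℝ → X → EuclideanSpace ℝ (Fin m) →L[ℝ] X)
    (t : ℝ) (x : X) (v : EuclideanSpace ℝ (Fin m)) : X →L[ℝ] X :=
  fderiv ℝ (f t) x + (fderiv ℝ (G t) x).flip v

lemma AssumptionAPlus.ae_hasFDerivAt_field (hA : AssumptionAPlus T f G)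
    (v : ℝ → EuclideanSpace ℝ (Fin m)) :
    ∀ᵐ t ∂(volume.restrict (Icc 0 T)), ∀ x,
      HasFDerivAt (fun x => field f G t x (v t)) (fieldDeriv f G t x (v t)) x := by
  filter_upwards [hA.contDiff] with t ht x
  have h1 := (ht.1.differentiable one_ne_zero x).hasFDerivAt
  have h2 := (ht.2.differentiable one_ne_zero x).hasFDerivAt
  have h3 := h2.clm_apply (hasFDerivAt_const (v t) x)
  simpa [field, fieldDeriv] using! h1.add h3

lemma AssumptionAPlus.aestronglyMeasurable_fieldDeriv (hA : AssumptionAPlus T f G)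
    {v : ℝ → EuclideanSpace ℝ (Fin m)} (hv : AEStronglyMeasurable v (volume.restrict (Icc 0 T)))
    (x : X) : AEStronglyMeasurable (fun t => fieldDeriv f G t x (v t))
      (volume.restrict (Icc 0 T)) := by
  have h := (ContinuousLinearMap.flipₗᵢ ℝ X (EuclideanSpace ℝ (Fin m))
    X).continuous.comp_aestronglyMeasurable (hA.meas_DG x)
  exact (hA.meas_Df x).add (isBoundedBilinearMap_apply.continuous.comp_aestronglyMeasurable
    (h.prodMk hv))

lemma AssumptionAPlus.exists_lipschitz_fieldDeriv (hA : AssumptionAPlus T f G) {R : ℝ}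
    (hR : 0 ≤ R) {v : ℝ → EuclideanSpace ℝ (Fin m)}
    (hvR : ∀ᵐ t ∂(volume.restrict (Icc 0 T)), ‖v t‖ ≤ R) :
    ∃ M, 0 ≤ M ∧ ∀ᵐ t ∂(volume.restrict (Icc 0 T)), ∀ x y,
      ‖fieldDeriv f G t x (v t) - fieldDeriv f G t y (v t)‖ ≤ M * ‖x - y‖ := by
  obtain ⟨M, hM, hb⟩ := hA.bounds
  refine ⟨M + M * R, by positivity, ?_⟩
  filter_upwards [hb, hvR] with t ht htR x y
  have e : fieldDeriv f G t x (v t) - fieldDeriv f G t y (v t)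
      = (fderiv ℝ (f t) x - fderiv ℝ (f t) y)
        + (fderiv ℝ (G t) x - fderiv ℝ (G t) y).flip (v t) := by
    ext z
    simp [fieldDeriv]
    abel
  have h1 : ‖(fderiv ℝ (G t) x - fderiv ℝ (G t) y).flip‖ ≤ M * ‖x - y‖ := by
    rw [ContinuousLinearMap.opNorm_flip]
    exact ht.2.2.2 x y
  have h2 := ((fderiv ℝ (G t) x - fderiv ℝ (G t) y).flip).le_of_opNorm_le h1 (v t)
  have h3 : M * ‖x - y‖ * ‖v t‖ ≤ M * ‖x - y‖ * R := by gcongr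
  rw [e]
  refine (norm_add_le _ _).trans ?_
  linarith [ht.2.2.1 x y]

/-- Mild solutions are the solutions of the Volterra equation with the truncated semigroup. -/
lemma isMildSolution_iff {S : ℝ → X →L[ℝ] X} {C L s : ℝ} {v : ℝ → EuclideanSpace ℝ (Fin m)}
    (hW : IsStrongFamily (fun r => S (max 0 (min r T))) C)
    (hF : IsCaratheodory (fun t x => field f G t x (v t)) (Icc 0 T) L) (hs : 0 ≤ s) {x : X}
    {y : ℝ → X} :
    IsMildSolution S f G T v s x y ↔
      IsVolterraSolution (fun r => S (max 0 (min r T))) (fun t x => field f G t x (v t)) s T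
        (fun t => S (max 0 (min (t - s) T)) x) y := by
  -- Since `0 ≤ s`, every elapsed time `t - τ` lies in `[0, T]`, where the truncation changes
  -- nothing.
  have hclip : ∀ t ∈ Icc s T, ∀ τ ∈ Icc s t, max 0 (min (t - τ) T) = t - τ := fun t ht τ hτ => by
    rw [min_eq_left (by linarith [ht.2, hτ.1]), max_eq_right (by linarith [hτ.2])]
  have hcongr : ∀ t ∈ Icc s T, ∀ ψ : ℝ → X,
      EqOn (fun τ => S (max 0 (min (t - τ) T)) (ψ τ)) (fun τ => S (t - τ) (ψ τ)) (uIcc s t) :=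
    fun t ht ψ τ hτ => by
      rw [uIcc_of_le ht.1] at hτ
      simp only [hclip t ht τ hτ]
  constructor
  · intro h
    refine ⟨h.continuousOn, fun t ht => ?_⟩
    rw [h.eq t ht, hclip t ht s ⟨le_rfl, ht.1⟩, intervalIntegral.integral_congr (hcongr t ht _)]
  · intro h
    refine ⟨h.continuousOn, fun t ht => ?_, fun t ht => ?_⟩
    · have hi := (h.isConvolution (hF.mono (Icc_subset_Icc_left hs))).integrableOn
      exact (hW.intervalIntegrable_conv hi ⟨le_rfl, ht.1.trans ht.2⟩ ht t).congr
        ((hcongr t ht _).mono uIoc_subset_uIcc)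
    · rw [h.eq t ht, hclip t ht s ⟨le_rfl, ht.1⟩, intervalIntegral.integral_congr (hcongr t ht _)]

end Control

end MildControl

/-! ### The increment formula -/

theorem proposition1 {X : Type*} [NormedAddCommGroup X] [NormedSpace ℝ X] [CompleteSpace X]
    {m : ℕ} (T : ℝ) (hT : 0 < T) (α : ℝ) (hα : 0 ≤ α)
    (A : X →ₗ.[ℝ] X) (S : ℝ → X →L[ℝ] X) (hS : IsC0Semigroup S) (hAS : IsGenerator A S)
    (f : ℝ → X → X) (G : ℝ → X → EuclideanSpace ℝ (Fin m) →L[ℝ] X)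
    (hA : AssumptionA T f G) (hAplus : AssumptionAPlus T f G)
    (ℓ : X → ℝ) (hℓ : ContDiff ℝ 1 ℓ)
    (hℓLip : ∀ B : Set X, Bornology.IsBounded B → ∃ K : ℝ≥0, LipschitzOnWith K ℓ B)
    (U : Set (EuclideanSpace ℝ (Fin m))) (hUcompact : IsCompact U) (hUconvex : Convex ℝ U)
    (u ubar : ℝ → EuclideanSpace ℝ (Fin m))
    (hu : IsAdmissible T U u) (hubar : IsAdmissible T U ubar) (x₀ : X) :
    -- mild solutions exist and are unique, so that the evolution maps are well defined
    (∀ v : ℝ → EuclideanSpace ℝ (Fin m), IsAdmissible T U v → ∀ s ∈ Icc 0 T, ∀ x : X,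
      IsMildSolution S f G T v s x (fun t => flow S f G T v s t x) ∧
      ∀ y : ℝ → X, IsMildSolution S f G T v s x y →
        EqOn y (fun t => flow S f G T v s t x) (Icc s T)) ∧
    -- the propagated cost is differentiable in the state
    (∀ t ∈ Icc 0 T, Differentiable ℝ (propCost S f G T ℓ ubar t)) ∧
    -- absolute continuity of its values along the trajectory of `u`
    AbsolutelyContinuousOnInterval
      (fun t => propCost S f G T ℓ ubar t (flow S f G T u 0 t x₀)) 0 T ∧
    -- the formula for the derivative
    (∀ᵐ t ∂(volume.restrict (Icc 0 T)),
      HasDerivAt (fun t => propCost S f G T ℓ ubar t (flow S f G T u 0 t x₀))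
        (inner ℝ (u t - ubar t)
          (adjointVec (G t (flow S f G T u 0 t x₀))
            (fderiv ℝ (propCost S f G T ℓ ubar t) (flow S f G T u 0 t x₀)))) t) ∧
    -- the exact formula for the increment of the cost
    IntegrableOn (fun t =>
      hamiltonian S f G T ℓ α ubar t (flow S f G T u 0 t x₀) (u t)
        - hamiltonian S f G T ℓ α ubar t (flow S f G T u 0 t x₀) (ubar t)) (Icc 0 T) ∧
    cost S f G T ℓ α x₀ u - cost S f G T ℓ α x₀ ubar =
      ∫ t in Icc 0 T,
        (hamiltonian S f G T ℓ α ubar t (flow S f G T u 0 t x₀) (u t)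
          - hamiltonian S f G T ℓ α ubar t (flow S f G T u 0 t x₀) (ubar t)) := by
  obtain ⟨R, hR, hUR⟩ : ∃ R, 0 ≤ R ∧ ∀ w ∈ U, ‖w‖ ≤ R := by
    obtain ⟨R, hR⟩ := hUcompact.isBounded.exists_norm_le
    exact ⟨max 0 R, le_max_left _ _, fun w hw => (hR w hw).trans (le_max_right _ _)⟩
  obtain ⟨C, hW⟩ := hS.exists_isStrongFamily T
  set W : ℝ → X →L[ℝ] X := fun r => S (max 0 (min r T)) with hWdef
  obtain ⟨L, hL⟩ := hA.exists_isCaratheodory hR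
  have hcar : ∀ v, IsAdmissible T U v →
      IsCaratheodory (fun t x => field f G t x (v t)) (Icc 0 T) L := fun v hv =>
    hL v hv.aestronglyMeasurable (hv.ae_norm_le hUR)
  have hmild : ∀ v, IsAdmissible T U v → ∀ s ∈ Icc 0 T, ∀ x,
      IsMildSolution S f G T v s x (fun t => flow S f G T v s t x) := by
    intro v hv s hs x
    obtain ⟨y, hy⟩ := exists_isVolterraSolution (a := fun t => W (t - s) x) hW
      ((hcar v hv).mono (Icc_subset_Icc_left hs.1)) hs.2
      ((hW.continuous_orbit x).comp (continuous_id.sub continuous_const)).continuousOn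
    have hex : ∃ y, IsMildSolution S f G T v s x y :=
      ⟨y, (isMildSolution_iff hW (hcar v hv) hs.1).2 hy⟩
    simpa only [flow, dif_pos hex] using! hex.choose_spec
  have hflow : ∀ v, IsAdmissible T U v → ∀ s ∈ Icc 0 T, ∀ x,
      IsVolterraSolution W (fun t x => field f G t x (v t)) s T (fun t => W (t - s) x)
        (fun t => flow S f G T v s t x) := fun v hv s hs x =>
    (isMildSolution_iff hW (hcar v hv) hs.1).1 (hmild v hv s hs x)
  have h0 : (0 : ℝ) ∈ Icc 0 T := ⟨le_rfl, hT.le⟩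
  have hTT : T ∈ Icc 0 T := ⟨hT.le, le_rfl⟩
  have hev : IsPerturbedEvolution W C L T (fun t x => field f G t x (u t))
      (fun t x => field f G t x (ubar t)) x₀ (fun t => flow S f G T u 0 t x₀)
      (fun s x t => flow S f G T ubar s t x) :=
    { family := hW
      map_zero := by simp [hWdef, hT.le, hS.map_zero]
      map_add := fun p q hp hq hpq => by
        simp only [hWdef]
        rw [min_eq_left hpq, min_eq_left (by linarith), min_eq_left (by linarith),
          max_eq_right hp, max_eq_right hq, max_eq_right (add_nonneg hp hq)]
        exact hS.map_add p q hp hq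
      field := hcar u hu
      field' := hcar ubar hubar
      trajectory := hflow u hu 0 h0 x₀
      evolution := hflow ubar hubar }
  have hdiff : ∀ t ∈ Icc 0 T, Differentiable ℝ (propCost S f G T ℓ ubar t) := by
    intro t ht
    obtain ⟨M, hM, hlip⟩ := hAplus.exists_lipschitz_fieldDeriv hR (hubar.ae_norm_le hUR)
    have hsub := Icc_subset_Icc_left (b := T) ht.1
    exact (hℓ.differentiable one_ne_zero).comp
      (IsVolterraSolution.differentiable (Y := fun x r => flow S f G T ubar t r x) hW
        ((hcar ubar hubar).mono hsub) ht.1 hM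
        (ae_restrict_of_ae_restrict_of_subset hsub (hAplus.ae_hasFDerivAt_field ubar))
        (fun x => (hAplus.aestronglyMeasurable_fieldDeriv hubar.aestronglyMeasurable
          x).mono_measure (Measure.restrict_mono_set _ hsub))
        (ae_restrict_of_ae_restrict_of_subset hsub hlip)
        (hflow ubar hubar t ht) ⟨ht.2, le_rfl⟩)
  obtain ⟨K, hK⟩ := hev.exists_lipschitzOnWith_cost hℓLip
  have hac : AbsolutelyContinuousOnInterval
      (fun t => propCost S f G T ℓ ubar t (flow S f G T u 0 t x₀)) 0 T :=
    LipschitzOnWith.absolutelyContinuousOnInterval (K := K) (by rwa [uIcc_of_le hT.le])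
  have hderiv : ∀ᵐ t ∂(volume.restrict (Icc 0 T)),
      HasDerivAt (fun t => propCost S f G T ℓ ubar t (flow S f G T u 0 t x₀))
        (inner ℝ (u t - ubar t)
          (adjointVec (G t (flow S f G T u 0 t x₀))
            (fderiv ℝ (propCost S f G T ℓ ubar t) (flow S f G T u 0 t x₀)))) t := by
    filter_upwards [hev.ae_hasDerivAt_cost hT.le hac hdiff] with t ht
    rw [inner_adjointVec]
    have e : field f G t (flow S f G T u 0 t x₀) (u t)
        - field f G t (flow S f G T u 0 t x₀) (ubar t)
        = G t (flow S f G T u 0 t x₀) (u t - ubar t) := by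
      simp [field]
    rw [e] at ht
    exact ht
  set g := fun t => propCost S f G T ℓ ubar t (flow S f G T u 0 t x₀) with hg
  have hsq : ∀ v, IsAdmissible T U v → IntegrableOn (fun t => ‖v t‖ ^ 2) (Icc 0 T) := by
    intro v hv
    refine Integrable.mono' (g := fun _ => R ^ 2) (integrable_const _)
      (hv.aestronglyMeasurable.norm.pow 2) ?_
    filter_upwards [hv.ae_norm_le hUR] with t ht
    rw [Real.norm_of_nonneg (by positivity)]
    gcongr
  -- Integrability of the Hamiltonian difference is inherited from `deriv g`, so measurability in
  -- time of the derivative of the propagated cost need not be studied.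
  have hgi : IntegrableOn (deriv g) (Icc 0 T) := by
    rw [integrableOn_Icc_iff_integrableOn_Ioc]
    exact (intervalIntegrable_iff_integrableOn_Ioc_of_le hT.le).1 hac.intervalIntegrable_deriv
  have hqi : IntegrableOn (fun t => α / 2 * ‖u t‖ ^ 2 - α / 2 * ‖ubar t‖ ^ 2) (Icc 0 T) :=
    ((hsq u hu).const_mul _).sub ((hsq ubar hubar).const_mul _)
  have hH : (fun t => α / 2 * ‖u t‖ ^ 2 - α / 2 * ‖ubar t‖ ^ 2 + deriv g t)
      =ᵐ[volume.restrict (Icc 0 T)] fun t =>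
        hamiltonian S f G T ℓ α ubar t (flow S f G T u 0 t x₀) (u t)
          - hamiltonian S f G T ℓ α ubar t (flow S f G T u 0 t x₀) (ubar t) := by
    filter_upwards [hderiv] with t ht
    rw [ht.deriv, hamiltonian, hamiltonian, inner_sub_left]
    ring
  refine ⟨fun v hv s hs x => ⟨hmild v hv s hs x, fun y hy => ?_⟩, hdiff, hac, hderiv,
    (hqi.add hgi).congr hH, ?_⟩
  · exact ((isMildSolution_iff hW (hcar v hv) hs.1).1 hy).eqOn hW
      ((hcar v hv).mono (Icc_subset_Icc_left hs.1)) hs.1 (hflow v hv s hs x)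
  -- The fundamental theorem of calculus turns the integral of `deriv g` into `g T - g 0`, the
  -- difference of terminal costs; the quadratic terms give the control costs.
  · rw [← integral_congr_ae hH, integral_add hqi hgi,
      integral_sub ((hsq u hu).const_mul _) ((hsq ubar hubar).const_mul _),
      integral_const_mul, integral_const_mul, integral_Icc_eq_integral_Ioc (f := deriv g),
      ← intervalIntegral.integral_of_le hT.le, hac.integral_deriv_eq_sub]
    have e0 : flow S f G T u 0 0 x₀ = x₀ := by
      have := (hflow u hu 0 h0 x₀).eq 0 h0
      simpa [hev.map_zero] using this
    have eT := hev.evolution_self hTT (flow S f G T u 0 T x₀)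
    simp only [hg, propCost, cost, e0]
    rw [eT]
    ring
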